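/- All graphs are finite, simple and undirected; $d$ is the shortest-path distance ($\infty$ between different components), and $N_\delta(v)=\{u : 1\le d(v,u)\le\delta\}$ for $\delta\in\mathbb N$. **Breadth-first colouring BFC-$\delta$.** For every vertex $v$ fix a breadth-first search from $v$ that visits $\{v\}\cup N_\delta(v)$, level by level (the level of $u$ being $d(v,u)$), with ties inside a level broken arbitrarily. A *tree edge* $(a,b)$ is an edge such that $b$ is discovered from $a$, the first visited neighbour of $b$, with $a$ visited before $b$; every other edge between visited vertices is a *back edge* and is directed from the later to the earlier vertex. Let $$\eta_v(u)=\{o : (o,u) \text{ is a tree edge, or } (u,o) \text{ is a back edge and } d(v,o)\ne d(v,u)\}.$$ Let $\rho:C\times\mathcal M(C)\to C$, $\phi:C\times C\to C$ and $\psi:\mathcal M(C)\to C$ be injective, where $C$ is a set of colours and $\mathcal M(C)$ is the set of finite multisets over $C$. Start with $\lambda^0(u)=\lambda^0_v(u)=c_0$ for a fixed colour $c_0$ and put $$\lambda_v^{l+1}(u)=\phi\bigl(\lambda^l(u),\psi(\{\!\!\{\lambda_v^l(w): w\in\eta_v(u)\}\!\!\})\bigr),\qquad \lambda^{l+1}(u)=\rho\bigl(\lambda^l(u),\{\!\!\{\lambda_v^{l+1}(u):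 v\in N_\delta(u)\}\!\!\}\bigr).$$ BFC-$\delta$ *distinguishes* $G$ and $H$ if $\{\!\!\{\lambda^l(u):u\in V_G\}\!\!\}\neq\{\!\!\{\lambda^l(u):u\in V_H\}\!\!\}$ for some $l$. **3-WL.** A triple of vertices initially gets as colour its pattern of equalities and adjacencies. In each round the new colour of $(v_1,v_2,v_3)$ consists of its old colour and, for each $i\in\{1,2,3\}$, of the multiset over all vertices $w$ of the old colours of the triple in which $v_i$ is replaced by $w$. 3-WL *distinguishes* $G$ and $H$ if after some round their multisets of colours of triples differ. **Theorem.** The expressive power of BFC-$\delta$ is strictly upper bounded by 3-WL, for every $\delta$: 1. For all $\delta\in\mathbb N$ and all graphs $G,H$, and whatever colours, injective functions and searches are used: if BFC-$\delta$ distinguishes $G$ and $H$, then 3-WL distinguishes $G$ and $H$. 2. There are graphs $G,H$ that 3-WL distinguishes but that BFC-$\delta$ does not distinguish for any $\delta$, whatever colours, injective functions and searches are used. -/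

import Mathlib

/-! ## Breadth-first search -/

/-- The `δ`-neighbourhood `N_δ(v) = {u | 1 ≤ d(v,u) ≤ δ}`, with `d` the shortest-path distance
(`∞` between different connected components). -/
def nbhd {V : Type*} (G : SimpleGraph V) (δ : ℕ) (v : V) : Set V :=
  {u | 1 ≤ G.edist v u ∧ G.edist v u ≤ δ}

/-- The vertices visited by a search from the root `v` whose range is `δ` hops:
the root and its `δ`-neighbourhood. -/
def visited {V : Type*} (G : SimpleGraph V) (δ : ℕ) (v : V) : Set V :=
  insert v (nbhd G δ v)

/-- A breadth-first search from the root `v` with range `δ`, given by the times at which the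
visited vertices are discovered. All vertices of one level (distance from the root) are discovered
before those of the next level; ties inside a level may be broken in any way. -/
structure BFS {V : Type*} (G : SimpleGraph V) (δ : ℕ) (v : V) where
  time : V → ℕ
  time_injOn : Set.InjOn time (visited G δ v)
  level_lt : ∀ a ∈ visited G δ v, ∀ b ∈ visited G δ v,
    G.edist v a < G.edist v b → time a < time b

namespace BFS

variable {V : Type*} {G : SimpleGraph V} {δ : ℕ} {v : V}

/-- Tree edges `(a, b)`, directed from the earlier to the later vertex: `b` is discovered from `a`,
the first visited among the neighbours of `b`. -/
def treeEdges (T : BFS G δ v) : Set (V × V) :=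
  {e | e.1 ∈ visited G δ v ∧ e.2 ∈ visited G δ v ∧ G.Adj e.1 e.2 ∧ T.time e.1 < T.time e.2 ∧
    ∀ c ∈ visited G δ v, G.Adj c e.2 → T.time e.1 ≤ T.time c}

/-- Back edges `(a, b)`: the other edges between visited vertices, directed from the later to the
earlier vertex. -/
def backEdges (T : BFS G δ v) : Set (V × V) :=
  {e | e.1 ∈ visited G δ v ∧ e.2 ∈ visited G δ v ∧ G.Adj e.1 e.2 ∧ T.time e.2 < T.time e.1 ∧
    (e.2, e.1) ∉ T.treeEdges}

/-- Searches exist. -/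
theorem nonempty [Finite V] (G : SimpleGraph V) (δ : ℕ) (v : V) : Nonempty (BFS G δ v) := by
  obtain ⟨n, ⟨e⟩⟩ := Finite.exists_equiv_fin V
  refine ⟨⟨fun u => (G.edist v u).toNat * n + e u, ?_, ?_⟩⟩
  · intro a _ b _ h
    have h2 := congrArg (· % n) h
    simp only [Nat.mul_add_mod_self_right] at h2
    rw [Nat.mod_eq_of_lt (e a).2, Nat.mod_eq_of_lt (e b).2] at h2
    exact e.injective (Fin.ext h2)
  · intro a ha b hb h
    have fin : ∀ x ∈ visited G δ v, G.edist v x ≠ ⊤ := by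
      rintro x (rfl | hx)
      · simp
      · exact ne_top_of_le_ne_top (ENat.natCast_ne_top δ) hx.2
    have h1 : (G.edist v a).toNat < (G.edist v b).toNat := by
      rw [← ENat.natCast_toNat (fin a ha), ← ENat.natCast_toNat (fin b hb)] at h
      exact_mod_cast h
    have h2 := (e a).2
    have h3 : ((G.edist v a).toNat + 1) * n ≤ (G.edist v b).toNat * n :=
      Nat.mul_le_mul_right n h1
    rw [Nat.add_mul, Nat.one_mul] at h3
    omega

end BFS

/-! ## Breadth-first colouring -/

/-- The vertices from which `u` receives colours in the search rooted at `v`: its tree parent, and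
the earlier endpoints of those back edges at `u` that join different levels. -/
def etaBFC {V : Type*} (G : SimpleGraph V) (v u : V) (Etree Eback : Set (V × V)) : Set V :=
  {o | (o, u) ∈ Etree ∨ ((u, o) ∈ Eback ∧ G.edist v o ≠ G.edist v u)}

/-- A colour set `C` with an initial colour and injective update functions. -/
structure ColourScheme (C : Type*) where
  init : C
  ρ : C × Multiset C → C
  φ : C × C → C
  ψ : Multiset C → C
  ρ_inj : Function.Injective ρ
  φ_inj : Function.Injective φ
  ψ_inj : Function.Injective ψ

/-- Colour schemes exist. -/
theorem ColourScheme.nonempty : Nonempty (ColourScheme ℕ) :=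
  ⟨⟨0, Encodable.encode, Encodable.encode, Encodable.encode,
    Encodable.encode_injective, Encodable.encode_injective, Encodable.encode_injective⟩⟩

open Classical in
/-- The multiset of the values of `f` on the vertices in `s`. -/
noncomputable def colourMultiset {V C : Type*} [Fintype V] (s : Set V) (f : V → C) : Multiset C :=
  (Finset.univ.filter (· ∈ s)).val.map f

/-- The colours after `l` iterations of BFC-`δ`, given a search `T v` for every root `v`:
the first component is `u ↦ λ^l(u)`, the second is `v u ↦ λ_v^l(u)`. The recursion is
`λ_v^{l+1}(u) = φ(λ^l(u), ψ {{λ_v^l(w) : w ∈ η(u)}})` and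
`λ^{l+1}(u) = ρ(λ^l(u), {{λ_v^{l+1}(u) : v ∈ N_δ(u)}})`. -/
noncomputable def bfc {V C : Type*} [Fintype V] (S : ColourScheme C) (G : SimpleGraph V) (δ : ℕ)
    (T : ∀ v, BFS G δ v) : ℕ → (V → C) × (V → V → C)
  | 0 => (fun _ => S.init, fun _ _ => S.init)
  | l + 1 =>
    let old := bfc S G δ T l
    let rooted : V → V → C := fun v u =>
      S.φ (old.1 u,
        S.ψ (colourMultiset (etaBFC G v u (T v).treeEdges (T v).backEdges) (old.2 v)))
    (fun u => S.ρ (old.1 u, colourMultiset (nbhd G δ u) (fun v => rooted v u)), rooted)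

/-- BFC-`δ`, run with the searches `T` on `G` and `T'` on `H`, distinguishes `G` and `H`: after
some number of iterations their multisets of vertex colours differ (they then differ ever after,
as `ρ` is injective). -/
def BFCDistinguishes {V W C : Type*} [Fintype V] [Fintype W] (S : ColourScheme C) (δ : ℕ)
    (G : SimpleGraph V) (H : SimpleGraph W) (T : ∀ v, BFS G δ v) (T' : ∀ w, BFS H δ w) : Prop :=
  ∃ l : ℕ, Finset.univ.val.map (bfc S G δ T l).1 ≠ Finset.univ.val.map (bfc S H δ T' l).1

/-! ## The `k`-dimensional Weisfeiler-Leman test -/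

/-- The colours of `k`-tuples after `l` rounds. Initially the atomic type of the tuple; a new colour
is the old one together with one multiset of old colours for each of the `k` positions. -/
def WLColour (k : ℕ) : ℕ → Type
  | 0 => Fin k → Fin k → Prop × Prop
  | l + 1 => WLColour k l × (Fin k → Multiset (WLColour k l))

open Classical in
/-- `k`-WL (for `k ≥ 2`) in its standard, non-folklore form: the tuple `t` starts with its
equality and adjacency pattern, and in each round it collects, separately for each position `i`, the
multiset of the colours of the tuples got by replacing the `i`-th entry by a vertex `w`. -/
noncomputable def wl {V : Type*} [Fintype V] (G : SimpleGraph V) (k : ℕ) :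
    (l : ℕ) → (Fin k → V) → WLColour k l
  | 0 => fun t i j => (t i = t j, G.Adj (t i) (t j))
  | l + 1 => fun t =>
      (wl G k l t, fun i => Finset.univ.val.map fun w : V => wl G k l (Function.update t i w))

open Classical in
/-- `k`-WL distinguishes `G` and `H`: after some number of rounds their multisets of colours of
`k`-tuples differ. -/
def WLDistinguishes {V W : Type*} [Fintype V] [Fintype W] (k : ℕ)
    (G : SimpleGraph V) (H : SimpleGraph W) : Prop :=
  ∃ l : ℕ, (Finset.univ : Finset (Fin k → V)).val.map (wl G k l) ≠
    (Finset.univ : Finset (Fin k → W)).val.map (wl H k l)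

/-!
In a breadth-first colouring the vertex `u` receives colours exactly from its neighbours that are
closer to the root `v`, whatever search is used. Hence a relation between pairs (root, vertex) of
two graphs which respects distances, and along which roots and closer neighbours can be matched
bijectively, also respects the colours.

For `k ≥ 3`, pairs that occur at the same two positions of `k`-tuples never separated by `k`-WL form
such a relation: a spare third position can be filled with any vertex and may then take over the
role of either of the other two positions, so walks can be carried over edge by edge.

In regular graphs in which any two distinct non-adjacent vertices have the same number `μ > 0` of
common neighbours, equality of distances is such a relation. The complements of the 8-cycle and of
two disjoint 4-cycles are of this kind with equal parameters, but `k`-WL sees the number of common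
neighbours of adjacent vertices, and only the latter has an edge with four of them.
-/

/-! ## Matching vertices -/

section Matching

variable {V W C : Type*} [Fintype V] [Fintype W]

theorem exists_equiv_of_map_univ_eq {f : V → C} {g : W → C}
    (h : Finset.univ.val.map f = Finset.univ.val.map g) : ∃ σ : V ≃ W, ∀ v, f v = g (σ v) := by
  classical
  have fibres (c : C) : Nonempty ({v // f v = c} ≃ {w // g w = c}) := by
    have hc := congrArg (Multiset.count c) h
    rw [Multiset.count_map, Multiset.count_map, ← Finset.filter_val, ← Finset.filter_val,
      Finset.card_val, Finset.card_val] at hc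
    rw [← Fintype.card_eq]
    simpa only [Fintype.card_subtype, eq_comm] using hc
  exact ⟨Equiv.ofFiberEquiv fun c => (fibres c).some,
    fun v => (Equiv.ofFiberEquiv_map (fun c => (fibres c).some) v).symm⟩

theorem map_univ_eq_of_equiv {f : V → C} {g : W → C} (σ : V ≃ W) (h : ∀ v, f v = g (σ v)) :
    Finset.univ.val.map f = Finset.univ.val.map g := by
  rw [← Multiset.map_univ_val_equiv σ, Multiset.map_map]
  exact Multiset.map_congr rfl fun v _ => h v

theorem exists_equiv_forall_eq_of_refining {C : ℕ → Type*} {f : ∀ l, V → C l} {g : ∀ l, W → C l}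
    (hrefine : ∀ l v w, f (l + 1) v = g (l + 1) w → f l v = g l w)
    (h : ∀ l, Finset.univ.val.map (f l) = Finset.univ.val.map (g l)) :
    ∃ σ : V ≃ W, ∀ v l, f l v = g l (σ v) := by
  -- There are finitely many bijections, so one of those for the single `l` serves all `l`.
  have exchange := iInf_iSup_of_antitone (f := fun (σ : V ≃ W) l => ∀ v, f l v = g l (σ v))
    fun σ => antitone_nat_of_succ_le fun l hl v => hrefine l v (σ v) (hl v)
  simp only [iInf_Prop_eq, iSup_Prop_eq] at exchange
  obtain ⟨σ, hσ⟩ := exchange.mp fun l => exists_equiv_of_map_univ_eq (h l)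
  exact ⟨σ, fun v l => hσ l v⟩

theorem exists_equiv_mem_iff_of_ncard_eq (hcard : Fintype.card V = Fintype.card W) {s : Set V}
    {t : Set W} (hst : s.ncard = t.ncard) : ∃ σ : V ≃ W, ∀ v, v ∈ s ↔ σ v ∈ t := by
  classical
  obtain ⟨e⟩ : Nonempty (V ≃ W) := Fintype.card_eq.1 hcard
  obtain ⟨f⟩ : Nonempty ({v // v ∈ s} ≃ {v // e v ∈ t}) := by
    rw [← Finite.card_eq]
    calc s.ncard = t.ncard := hst
      _ = (e ⁻¹' t).ncard :=
        (Set.ncard_preimage_of_injective_subset_range e.injective (by simp)).symm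
  refine ⟨f.extendSubtype.trans e, fun v => ⟨f.extendSubtype_mem v, fun h => ?_⟩⟩
  by_contra hv
  exact f.extendSubtype_not_mem v hv h

theorem colourMultiset_congr {s : Set V} {t : Set W} {f : V → C} {g : W → C} (σ : V ≃ W)
    (hst : ∀ v, v ∈ s ↔ σ v ∈ t) (hfg : ∀ v ∈ s, f v = g (σ v)) :
    colourMultiset s f = colourMultiset t g := by
  classical
  have ht : Finset.univ.filter (· ∈ t) = (Finset.univ.filter (· ∈ s)).map σ.toEmbedding := by
    ext w
    obtain ⟨v, rfl⟩ := σ.surjective w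
    simp [hst]
  unfold colourMultiset
  rw [ht, Finset.map_val, Multiset.map_map]
  exact Multiset.map_congr rfl fun v hv => hfg v (by simpa using hv)

end Matching

/-! ## Colours along shortest paths -/

/-- The neighbours of `u` that are closer to `v`, that is, the last but one vertices of the shortest
paths from `v` to `u`. A breadth-first colouring rooted at `v` sends colours along these edges. -/
def predecessors {V : Type*} (G : SimpleGraph V) (v u : V) : Set V :=
  {w | G.Adj w u ∧ G.edist v w < G.edist v u}

section Predecessors

variable {V : Type*} {G : SimpleGraph V} {δ : ℕ} {v u w : V}

theorem edist_le_edist_add_one_of_adj (v : V) (h : G.Adj w u) :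
    G.edist v u ≤ G.edist v w + 1 :=
  SimpleGraph.edist_triangle.trans_eq (by rw [SimpleGraph.edist_eq_one_iff_adj.2 h])

theorem edist_add_one_eq_of_mem_predecessors (h : w ∈ predecessors G v u) :
    G.edist v w + 1 = G.edist v u :=
  (Order.add_one_le_of_lt h.2).antisymm (edist_le_edist_add_one_of_adj v h.1)

theorem predecessors_nonempty (hne : v ≠ u) (hfin : G.edist v u ≠ ⊤) :
    (predecessors G v u).Nonempty := by
  obtain ⟨p, hp⟩ := SimpleGraph.exists_walk_of_edist_ne_top (SimpleGraph.edist_comm ▸ hfin)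
  cases p with
  | nil => exact absurd rfl hne
  | @cons _ w _ huw p =>
    have hlt : G.edist w v < G.edist u v := by
      refine (SimpleGraph.edist_le p).trans_lt (hp ▸ ?_)
      exact_mod_cast Nat.lt_succ_self p.length
    exact ⟨w, huw.symm, by simpa only [SimpleGraph.edist_comm] using hlt⟩

theorem predecessors_self (v : V) : predecessors G v v = ∅ := by
  ext w
  simp [predecessors]

theorem predecessors_eq_singleton_of_adj (h : G.Adj v u) : predecessors G v u = {v} := by
  ext w
  simp only [predecessors, Set.mem_ofPred_eq, Set.mem_singleton_iff,
    SimpleGraph.edist_eq_one_iff_adj.2 h, Order.lt_one_iff, SimpleGraph.edist_eq_zero_iff]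
  exact ⟨fun hw => hw.2.symm, fun hw => ⟨hw ▸ h, hw.symm⟩⟩

theorem predecessors_eq_commonNeighbors (h : G.edist v u = 2) :
    predecessors G v u = G.commonNeighbors v u := by
  obtain ⟨-, hnadj, -⟩ := SimpleGraph.edist_eq_two_iff.1 h
  ext w
  have hlt : G.edist v w < 2 ↔ G.Adj v w ∨ v = w := by
    rw [← SimpleGraph.edist_le_one_iff_adj_or_eq, ← one_add_one_eq_two,
      ENat.lt_add_one_iff ENat.one_ne_top]
  simp only [predecessors, Set.mem_ofPred_eq, SimpleGraph.mem_commonNeighbors, h, hlt]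
  constructor
  · rintro ⟨hwu, hvw | rfl⟩
    · exact ⟨hvw, hwu.symm⟩
    · exact absurd hwu hnadj
  · exact fun ⟨hvw, huw⟩ => ⟨huw.symm, .inl hvw⟩

theorem mem_visited_iff : u ∈ visited G δ v ↔ G.edist v u ≤ δ := by
  rcases eq_or_ne v u with rfl | hne
  · simp [visited]
  · simp [visited, nbhd, hne.symm, Order.one_le_iff_pos, SimpleGraph.edist_pos_of_ne hne]

namespace BFS

theorem edist_le_of_time_le (T : BFS G δ v) (hu : u ∈ visited G δ v) (hw : w ∈ visited G δ v)
    (h : T.time u ≤ T.time w) : G.edist v u ≤ G.edist v w :=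
  le_of_not_gt fun hlt => (T.level_lt w hw u hu hlt).not_ge h

theorem edist_lt_of_mem_treeEdges (T : BFS G δ v) (h : (w, u) ∈ T.treeEdges) :
    G.edist v w < G.edist v u := by
  obtain ⟨hw, hu, hadj, htime, hfirst⟩ := h
  have hne : v ≠ u := by
    rintro rfl
    have hwv := T.edist_le_of_time_le hw hu htime.le
    rw [SimpleGraph.edist_self, nonpos_iff_eq_zero, SimpleGraph.edist_eq_zero_iff] at hwv
    exact hadj.ne hwv.symm
  have hfin : G.edist v u ≠ ⊤ :=
    ne_top_of_le_ne_top (ENat.natCast_ne_top δ) (mem_visited_iff.1 hu)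
  obtain ⟨c, hcu, hlt⟩ := predecessors_nonempty hne hfin
  have hc : c ∈ visited G δ v := mem_visited_iff.2 (hlt.le.trans (mem_visited_iff.1 hu))
  exact (T.edist_le_of_time_le hw hc (hfirst c hc hcu)).trans_lt hlt

theorem mem_etaBFC_iff (T : BFS G δ v) :
    w ∈ etaBFC G v u T.treeEdges T.backEdges ↔ u ∈ visited G δ v ∧ w ∈ predecessors G v u := by
  constructor
  · rintro (htree | ⟨⟨hu, hw, hadj, htime, -⟩, hne⟩)
    · exact ⟨htree.2.1, htree.2.2.1, T.edist_lt_of_mem_treeEdges htree⟩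
    · exact ⟨hu, hadj.symm, (T.edist_le_of_time_le hw hu htime.le).lt_of_ne hne⟩
  · rintro ⟨hu, hadj, hlt⟩
    have hw : w ∈ visited G δ v := mem_visited_iff.2 (hlt.le.trans (mem_visited_iff.1 hu))
    by_cases htree : (w, u) ∈ T.treeEdges
    · exact .inl htree
    · exact .inr ⟨⟨hu, hw, hadj.symm, T.level_lt w hw u hu hlt, htree⟩, hlt.ne⟩

end BFS

end Predecessors

/-- A relation `R v u v' u'` between pairs (root, vertex) of `G` and of `H` along which
breadth-first colours can be compared: it preserves distances, and related pairs have matching roots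
and matching predecessors. -/
structure BFCBisimulation {V W : Type*} (G : SimpleGraph V) (H : SimpleGraph W)
    (R : V → V → W → W → Prop) : Prop where
  edist_eq {v u v' u'} : R v u v' u' → G.edist v u = H.edist v' u'
  exists_equiv_root {v u v' u'} : R v u v' u' → ∃ σ : V ≃ W, ∀ x, R x u (σ x) u'
  exists_equiv_predecessors {v u v' u'} : R v u v' u' → ∃ σ : V ≃ W, ∀ w,
    (w ∈ predecessors G v u ↔ σ w ∈ predecessors H v' u') ∧
      (w ∈ predecessors G v u → R v w v' (σ w))

namespace BFCBisimulation

variable {V W C : Type*} [Fintype V] [Fintype W] {G : SimpleGraph V} {H : SimpleGraph W}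
  {R : V → V → W → W → Prop} {S : ColourScheme C} {δ : ℕ} {T : ∀ v, BFS G δ v}
  {T' : ∀ w, BFS H δ w}

theorem bfc_eq (hR : BFCBisimulation G H R) (l : ℕ) {v u : V} {v' u' : W} (h : R v u v' u') :
    (bfc S G δ T l).1 u = (bfc S H δ T' l).1 u' ∧
      (bfc S G δ T l).2 v u = (bfc S H δ T' l).2 v' u' := by
  induction l generalizing v u v' u' with
  | zero => exact ⟨rfl, rfl⟩
  | succ l ih =>
    have rooted {v u v' u'} (h : R v u v' u') :
        (bfc S G δ T (l + 1)).2 v u = (bfc S H δ T' (l + 1)).2 v' u' := by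
      obtain ⟨σ, hσ⟩ := hR.exists_equiv_predecessors h
      refine congrArg S.φ (Prod.ext (ih h).1 (congrArg S.ψ ?_))
      refine colourMultiset_congr σ (fun w => ?_) fun w hw =>
        (ih ((hσ w).2 ((BFS.mem_etaBFC_iff _).1 hw).2)).2
      rw [BFS.mem_etaBFC_iff, BFS.mem_etaBFC_iff, mem_visited_iff, mem_visited_iff,
        hR.edist_eq h, (hσ w).1]
    refine ⟨?_, rooted h⟩
    obtain ⟨σ, hσ⟩ := hR.exists_equiv_root h
    refine congrArg S.ρ (Prod.ext (ih h).1 ?_)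
    refine colourMultiset_congr σ (fun x => ?_) fun x _ => rooted (hσ x)
    simp only [nbhd, Set.mem_ofPred_eq]
    rw [SimpleGraph.edist_comm, hR.edist_eq (hσ x), SimpleGraph.edist_comm]

theorem not_bfcDistinguishes (hR : BFCBisimulation G H R) (τ : V ≃ W)
    (hτ : ∀ u, ∃ v v', R v u v' (τ u)) : ¬ BFCDistinguishes S δ G H T T' := by
  rintro ⟨l, hl⟩
  refine hl (map_univ_eq_of_equiv τ fun u => ?_)
  obtain ⟨v, v', h⟩ := hτ u
  exact (hR.bfc_eq l h).1

end BFCBisimulation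

/-! ## Pairs that the Weisfeiler-Leman test never separates -/

/-- `k`-WL gives the tuples `t` and `t'` the same colour in every round. -/
def WLEquiv {V W : Type*} [Fintype V] [Fintype W] {k : ℕ} (G : SimpleGraph V) (H : SimpleGraph W)
    (t : Fin k → V) (t' : Fin k → W) : Prop :=
  ∀ l, wl G k l t = wl H k l t'

/-- The pairs `(v, u)` and `(v', u')` occur at the same two positions of `k`-tuples to which `k`-WL
gives the same colour in every round. -/
def WLPairEquiv {V W : Type*} [Fintype V] [Fintype W] (k : ℕ) (G : SimpleGraph V)
    (H : SimpleGraph W) (v u : V) (v' u' : W) : Prop :=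
  ∃ (t : Fin k → V) (t' : Fin k → W) (i j : Fin k), WLEquiv G H t t' ∧ i ≠ j ∧
    (t i = v ∧ t j = u) ∧ t' i = v' ∧ t' j = u'

section WeisfeilerLeman

variable {V W : Type*} [Fintype V] [Fintype W] {G : SimpleGraph V} {H : SimpleGraph W} {k : ℕ}

namespace WLEquiv

variable {t : Fin k → V} {t' : Fin k → W}

theorem symm (h : WLEquiv G H t t') : WLEquiv H G t' t := fun l => (h l).symm

theorem eq_iff (h : WLEquiv G H t t') (i j : Fin k) : t i = t j ↔ t' i = t' j :=
  iff_of_eq (congrArg Prod.fst (congrFun₂ (h 0) i j))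

theorem adj_iff (h : WLEquiv G H t t') (i j : Fin k) :
    G.Adj (t i) (t j) ↔ H.Adj (t' i) (t' j) :=
  iff_of_eq (congrArg Prod.snd (congrFun₂ (h 0) i j))

theorem exists_equiv_update (h : WLEquiv G H t t') (i : Fin k) :
    ∃ σ : V ≃ W, ∀ w, WLEquiv G H (Function.update t i w) (Function.update t' i (σ w)) :=
  exists_equiv_forall_eq_of_refining
    (f := fun l w => wl G k l (Function.update t i w))
    (g := fun l w => wl H k l (Function.update t' i w))
    (fun _ _ _ hl => congrArg Prod.fst hl) fun l => congrFun (congrArg Prod.snd (h (l + 1))) i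

end WLEquiv

theorem exists_equiv_wlEquiv_of_not_wlDistinguishes (h : ¬ WLDistinguishes k G H) :
    ∃ σ : (Fin k → V) ≃ (Fin k → W), ∀ t, WLEquiv G H t (σ t) := by
  classical
  refine exists_equiv_forall_eq_of_refining (fun _ _ _ hl => congrArg Prod.fst hl) fun l => ?_
  convert not_not.1 (not_exists.1 h l)

namespace WLPairEquiv

variable {v u : V} {v' u' : W}

theorem symm (h : WLPairEquiv k G H v u v' u') : WLPairEquiv k H G v' u' v u :=
  let ⟨t, t', i, j, ht, hij, htG, htH⟩ := h
  ⟨t', t, i, j, ht.symm, hij, htH, htG⟩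

theorem eq_iff (h : WLPairEquiv k G H v u v' u') : v = u ↔ v' = u' := by
  obtain ⟨t, t', i, j, ht, -, ⟨rfl, rfl⟩, rfl, rfl⟩ := h
  exact ht.eq_iff i j

theorem adj_iff (h : WLPairEquiv k G H v u v' u') : G.Adj v u ↔ H.Adj v' u' := by
  obtain ⟨t, t', i, j, ht, -, ⟨rfl, rfl⟩, rfl, rfl⟩ := h
  exact ht.adj_iff i j

theorem exists_equiv (hk : 2 < k) (h : WLPairEquiv k G H v u v' u') :
    ∃ σ : V ≃ W, ∀ w, WLPairEquiv k G H v w v' (σ w) ∧ WLPairEquiv k G H w u (σ w) u' := by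
  obtain ⟨t, t', i, j, ht, -, ⟨rfl, rfl⟩, rfl, rfl⟩ := h
  obtain ⟨m, hmi, hmj⟩ := Fin.exists_ne_and_ne_of_two_lt i j hk
  obtain ⟨σ, hσ⟩ := ht.exists_equiv_update m
  exact ⟨σ, fun w => ⟨⟨_, _, i, m, hσ w, hmi.symm, by simp [hmi.symm]⟩,
    ⟨_, _, m, j, hσ w, hmj, by simp [hmj.symm]⟩⟩⟩

theorem edist_le_length (hk : 2 < k) (h : WLPairEquiv k G H v u v' u') (p : G.Walk u v) :
    H.edist v' u' ≤ p.length := by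
  induction p generalizing u' with
  | nil => simp [h.eq_iff.1 rfl]
  | @cons u x v hux p ih =>
    obtain ⟨σ, hσ⟩ := h.exists_equiv hk
    have hadj : H.Adj (σ x) u' := (hσ x).2.adj_iff.1 hux.symm
    calc H.edist v' u' ≤ H.edist v' (σ x) + 1 := edist_le_edist_add_one_of_adj v' hadj
      _ ≤ p.length + 1 := by gcongr; exact ih (hσ x).1
      _ = (p.cons hux).length := by simp

theorem edist_le (hk : 2 < k) (h : WLPairEquiv k G H v u v' u') :
    H.edist v' u' ≤ G.edist v u := by
  rw [SimpleGraph.edist_comm (u := v)]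
  exact le_iInf (h.edist_le_length hk)

theorem edist_eq (hk : 2 < k) (h : WLPairEquiv k G H v u v' u') :
    G.edist v u = H.edist v' u' :=
  (h.symm.edist_le hk).antisymm (h.edist_le hk)

theorem ncard_commonNeighbors_eq (hk : 2 < k) (h : WLPairEquiv k G H v u v' u') :
    (G.commonNeighbors v u).ncard = (H.commonNeighbors v' u').ncard := by
  obtain ⟨σ, hσ⟩ := h.exists_equiv hk
  have hpre : G.commonNeighbors v u = σ ⁻¹' H.commonNeighbors v' u' := by
    ext w
    simp only [Set.mem_preimage, SimpleGraph.mem_commonNeighbors, G.adj_comm u, H.adj_comm u',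
      (hσ w).1.adj_iff, (hσ w).2.adj_iff]
  rw [hpre, Set.ncard_preimage_of_injective_subset_range σ.injective (by simp)]

theorem bfcBisimulation (hk : 2 < k) : BFCBisimulation G H (WLPairEquiv k G H) where
  edist_eq h := h.edist_eq hk
  exists_equiv_root h := (h.exists_equiv hk).imp fun _ hσ x => (hσ x).2
  exists_equiv_predecessors h := by
    obtain ⟨σ, hσ⟩ := h.exists_equiv hk
    refine ⟨σ, fun w => ⟨?_, fun _ => (hσ w).1⟩⟩
    simp only [predecessors, Set.mem_ofPred_eq, (hσ w).2.adj_iff, (hσ w).1.edist_eq hk,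
      h.edist_eq hk]

end WLPairEquiv

theorem exists_wlPairEquiv_of_not_wlDistinguishes (hk : 1 < k) (h : ¬ WLDistinguishes k G H)
    (v u : V) : ∃ v' u', WLPairEquiv k G H v u v' u' := by
  obtain ⟨σ, hσ⟩ := exists_equiv_wlEquiv_of_not_wlDistinguishes h
  have : Nontrivial (Fin k) := Fin.nontrivial_iff_two_le.2 hk
  obtain ⟨i, j, hij⟩ := exists_pair_ne (Fin k)
  exact ⟨_, _, _, _, i, j, hσ (Function.update (fun _ => u) i v), hij, by simp [hij.symm], rfl, rfl⟩

theorem wlDistinguishes_of_bfcDistinguishes {C : Type*} {S : ColourScheme C} {δ : ℕ}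
    {T : ∀ v, BFS G δ v} {T' : ∀ w, BFS H δ w} (hk : 2 < k) (h : BFCDistinguishes S δ G H T T') :
    WLDistinguishes k G H := by
  by_contra hn
  obtain ⟨τ, hτ⟩ : ∃ τ : V ≃ W, ∀ u, ∃ v v', WLPairEquiv k G H v u v' (τ u) := by
    obtain hV | ⟨⟨v⟩⟩ := isEmpty_or_nonempty V
    · obtain ⟨σ, -⟩ := exists_equiv_wlEquiv_of_not_wlDistinguishes hn
      have : IsEmpty W := ⟨fun w => hV.elim (σ.symm (fun _ => w) ⟨0, by lia⟩)⟩
      exact ⟨Equiv.equivOfIsEmpty V W, hV.elim⟩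
    · obtain ⟨v', u', hvu⟩ := exists_wlPairEquiv_of_not_wlDistinguishes (by lia) hn v v
      obtain ⟨τ, hτ⟩ := hvu.exists_equiv hk
      exact ⟨τ, fun u => ⟨v, v', (hτ u).1⟩⟩
  exact (WLPairEquiv.bfcBisimulation hk).not_bfcDistinguishes τ hτ h

theorem wlDistinguishes_of_ncard_commonNeighbors_ne {a b : V} (hk : 2 < k) (hab : G.Adj a b)
    (hne : ∀ a' b', H.Adj a' b' →
      (G.commonNeighbors a b).ncard ≠ (H.commonNeighbors a' b').ncard) :
    WLDistinguishes k G H := by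
  by_contra hn
  obtain ⟨a', b', h⟩ := exists_wlPairEquiv_of_not_wlDistinguishes (by lia) hn a b
  exact hne a' b' (h.adj_iff.1 hab) (h.ncard_commonNeighbors_eq hk)

end WeisfeilerLeman

/-! ## Co-edge-regular graphs -/

/-- Co-edge-regular graphs: regular of degree `r`, and any two distinct non-adjacent vertices have
exactly `μ` common neighbours. Strongly regular graphs (`SimpleGraph.IsSRGWith`) satisfy in addition
a condition on adjacent vertices. -/
structure IsCoEdgeRegular {V : Type*} (G : SimpleGraph V) (r μ : ℕ) : Prop where
  ncard_neighborSet (v : V) : (G.neighborSet v).ncard = r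
  ncard_commonNeighbors {v u : V} : v ≠ u → ¬ G.Adj v u → (G.commonNeighbors v u).ncard = μ

namespace IsCoEdgeRegular

variable {V W : Type*} {G : SimpleGraph V} {H : SimpleGraph W} {r μ : ℕ}

open Classical in
theorem edist_eq_ite (hG : IsCoEdgeRegular G r μ) (hμ : 0 < μ) (v u : V) :
    G.edist v u = if v = u then 0 else if G.Adj v u then 1 else 2 := by
  split_ifs with heq hadj
  · exact SimpleGraph.edist_eq_zero_iff.2 heq
  · exact SimpleGraph.edist_eq_one_iff_adj.2 hadj
  · refine SimpleGraph.edist_eq_two_iff.2 ⟨heq, hadj, Set.nonempty_of_ncard_ne_zero ?_⟩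
    exact hG.ncard_commonNeighbors heq hadj ▸ hμ.ne'

open Classical in
theorem ncard_predecessors (hG : IsCoEdgeRegular G r μ) (hμ : 0 < μ) (v u : V) :
    (predecessors G v u).ncard = if v = u then 0 else if G.Adj v u then 1 else μ := by
  split_ifs with heq hadj
  · rw [heq, predecessors_self, Set.ncard_empty]
  · rw [predecessors_eq_singleton_of_adj hadj, Set.ncard_singleton]
  · have htwo : G.edist v u = 2 := by rw [hG.edist_eq_ite hμ, if_neg heq, if_neg hadj]
    rw [predecessors_eq_commonNeighbors htwo, hG.ncard_commonNeighbors heq hadj]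

theorem ncard_predecessors_eq (hG : IsCoEdgeRegular G r μ) (hH : IsCoEdgeRegular H r μ)
    (hμ : 0 < μ) {v u : V} {v' u' : W} (h : G.edist v u = H.edist v' u') :
    (predecessors G v u).ncard = (predecessors H v' u').ncard := by
  classical
  have heq : v = u ↔ v' = u' := by
    rw [← SimpleGraph.edist_eq_zero_iff, h, SimpleGraph.edist_eq_zero_iff]
  have hadj : G.Adj v u ↔ H.Adj v' u' := by
    rw [← SimpleGraph.edist_eq_one_iff_adj, h, SimpleGraph.edist_eq_one_iff_adj]
  simp only [hG.ncard_predecessors hμ, hH.ncard_predecessors hμ, heq, hadj]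

variable [Fintype V] [Fintype W]

theorem exists_equiv_edist_eq (hG : IsCoEdgeRegular G r μ) (hH : IsCoEdgeRegular H r μ)
    (hμ : 0 < μ) (hcard : Fintype.card V = Fintype.card W) (u : V) (u' : W) :
    ∃ σ : V ≃ W, ∀ x, G.edist x u = H.edist (σ x) u' := by
  classical
  obtain ⟨σ, hσ⟩ := exists_equiv_mem_iff_of_ncard_eq hcard
    ((hG.ncard_neighborSet u).trans (hH.ncard_neighborSet u').symm)
  have hu : ¬ H.Adj u' (σ u) := (hσ u).not.1 G.irrefl
  -- Neither `σ u` nor `u'` is a neighbour of `u'`, so swapping them keeps the matching.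
  refine ⟨σ.trans (Equiv.swap (σ u) u'), fun x => ?_⟩
  have heq : x = u ↔ σ.trans (Equiv.swap (σ u) u') x = u' := by
    rw [← (σ.trans (Equiv.swap (σ u) u')).apply_eq_iff_eq, Equiv.trans_apply σ _ u,
      Equiv.swap_apply_left]
  have hadj : G.Adj x u ↔ H.Adj (σ.trans (Equiv.swap (σ u) u') x) u' := by
    rw [G.adj_comm, H.adj_comm, Equiv.trans_apply]
    refine (hσ x).trans ?_
    rcases eq_or_ne (σ x) (σ u) with h | h
    · simp [h, hu]
    · rcases eq_or_ne (σ x) u' with h' | h'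
      · simp [h', hu]
      · rw [Equiv.swap_apply_of_ne_of_ne h h', SimpleGraph.mem_neighborSet]
  simp only [hG.edist_eq_ite hμ, hH.edist_eq_ite hμ, heq, hadj]

theorem bfcBisimulation (hG : IsCoEdgeRegular G r μ) (hH : IsCoEdgeRegular H r μ)
    (hμ : 0 < μ) (hcard : Fintype.card V = Fintype.card W) :
    BFCBisimulation G H fun v u v' u' => G.edist v u = H.edist v' u' where
  edist_eq h := h
  exists_equiv_root _ := hG.exists_equiv_edist_eq hH hμ hcard _ _
  exists_equiv_predecessors h := by
    obtain ⟨σ, hσ⟩ :=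
      exists_equiv_mem_iff_of_ncard_eq hcard (hG.ncard_predecessors_eq hH hμ h)
    refine ⟨σ, fun w => ⟨hσ w, fun hw => WithTop.add_right_cancel ENat.one_ne_top ?_⟩⟩
    exact (edist_add_one_eq_of_mem_predecessors hw).trans
      (h.trans (edist_add_one_eq_of_mem_predecessors ((hσ w).1 hw)).symm)

theorem not_bfcDistinguishes (hG : IsCoEdgeRegular G r μ) (hH : IsCoEdgeRegular H r μ)
    (hμ : 0 < μ) (hcard : Fintype.card V = Fintype.card W) {C : Type*} {S : ColourScheme C} {δ : ℕ}
    {T : ∀ v, BFS G δ v} {T' : ∀ w, BFS H δ w} : ¬ BFCDistinguishes S δ G H T T' :=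
  (hG.bfcBisimulation hH hμ hcard).not_bfcDistinguishes (Fintype.equivOfCardEq hcard)
    fun u => ⟨u, Fintype.equivOfCardEq hcard u, by simp⟩

end IsCoEdgeRegular

/-- The complement of the circulant graph on `ℤ/8` with jumps `±s`: the complement of an 8-cycle for
`s = 1`, and of two disjoint 4-cycles for `s = 2`. -/
abbrev coCirculant (s : Fin 8) : SimpleGraph (Fin 8) :=
  (SimpleGraph.circulantGraph {s})ᶜ

theorem isCoEdgeRegular_coCirculant {s : Fin 8} (hs : s = 1 ∨ s = 2) :
    IsCoEdgeRegular (coCirculant s) 5 4 where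
  ncard_neighborSet v := by
    rw [Set.ncard_eq_toFinset_card']
    rcases hs with rfl | rfl <;> revert v <;> decide
  ncard_commonNeighbors {v u} := by
    rw [Set.ncard_eq_toFinset_card']
    rcases hs with rfl | rfl <;> revert v u <;> decide

theorem ncard_commonNeighbors_coCirculant_two :
    ((coCirculant 2).commonNeighbors 0 4).ncard = 4 := by
  rw [Set.ncard_eq_toFinset_card']
  decide

theorem ncard_commonNeighbors_coCirculant_one_lt {a b : Fin 8} (h : (coCirculant 1).Adj a b) :
    ((coCirculant 1).commonNeighbors a b).ncard < 4 := by
  rw [Set.ncard_eq_toFinset_card']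
  revert a b
  decide

theorem wlDistinguishes_coCirculant {k : ℕ} (hk : 2 < k) :
    WLDistinguishes k (coCirculant 2) (coCirculant 1) := by
  refine wlDistinguishes_of_ncard_commonNeighbors_ne hk (a := 0) (b := 4) (by decide)
    fun a b hab => ?_
  rw [ncard_commonNeighbors_coCirculant_two]
  exact (ncard_commonNeighbors_coCirculant_one_lt hab).ne'

theorem mainTheorem1_general {k : ℕ} (hk : 2 < k) :
    (∀ (δ : ℕ) (V : Type*) (W : Type*) [Fintype V] [Fintype W]
        (G : SimpleGraph V) (H : SimpleGraph W)
        (C : Type*) (S : ColourScheme C) (T : ∀ v, BFS G δ v) (T' : ∀ w, BFS H δ w),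
        BFCDistinguishes S δ G H T T' → WLDistinguishes k G H) ∧
      ∃ (n : ℕ) (G H : SimpleGraph (Fin n)), WLDistinguishes k G H ∧
        ∀ (δ : ℕ) (C : Type*) (S : ColourScheme C) (T : ∀ v, BFS G δ v) (T' : ∀ w, BFS H δ w),
          ¬ BFCDistinguishes S δ G H T T' :=
  ⟨fun _ _ _ _ _ _ _ _ _ _ _ => wlDistinguishes_of_bfcDistinguishes hk,
    8, coCirculant 2, coCirculant 1, wlDistinguishes_coCirculant hk,
    fun _ _ _ _ _ => (isCoEdgeRegular_coCirculant (.inr rfl)).not_bfcDistinguishes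
      (isCoEdgeRegular_coCirculant (.inl rfl)) four_pos rfl⟩

theorem mainTheorem1 :
    (∀ (δ : ℕ) (V : Type*) (W : Type*) [Fintype V] [Fintype W]
        (G : SimpleGraph V) (H : SimpleGraph W)
        (C : Type*) (S : ColourScheme C) (T : ∀ v, BFS G δ v) (T' : ∀ w, BFS H δ w),
        BFCDistinguishes S δ G H T T' → WLDistinguishes 3 G H) ∧
      ∃ (n : ℕ) (G H : SimpleGraph (Fin n)), WLDistinguishes 3 G H ∧
        ∀ (δ : ℕ) (C : Type*) (S : ColourScheme C) (T : ∀ v, BFS G δ v) (T' : ∀ w, BFS H δ w),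
          ¬ BFCDistinguishes S δ G H T T' :=
  mainTheorem1_general (Nat.lt_succ_self 2)
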